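/- **Theorem (Consistency of nested convex PCA).** Let $H$ be a finite dimensional real Hilbert space and $X\subset H$ a compact convex set with nonempty interior. Let $CL(X)$ be the set of nonempty closed subsets of $X$ with the Hausdorff distance, let $\mathcal P(X)$ be the set of Borel probability measures on $X$ with the topology of weak convergence, and for $C\in CL(X)$, $\nu\in\mathcal P(X)$ put $J(C;\nu)=\int \mathsf d(y,C)^2\,\nu(dy)$. For $z\in X$ and $j\ge 0$ let $CC_{z,j}(X)$ be the set of convex $C\in CL(X)$ with $z\in C$ and affine dimension $\dim C\le j$. A *sequentially optimal chain of length $j$ for $(z,\nu)$* is a sequence $\{z\}=D_0\subset D_1\subset\dots\subset D_j$ such that, for $\ell=1,\dots,j$, $D_\ell$ minimizes $J(\cdot;\nu)$ over $\{C\in CC_{z,\ell}(X): C\supset D_{\ell-1}\}$. A *$(j,z,\nu)$-nested convex principal component (CPC)* is the last set $D_j$ of such a chain. For a subset $\mathfrak A\subset CL(X)$ let $\chi_{\mathfrak A}$ be $0$ on $\mathfrak A$ and $+\infty$ off it. Functions $F_n:CL(X)\to[-\infty,\infty]$ *$\Gamma$-converge* to $F$ if for every $C$: $F(C)\le\liminf_n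 F_n(C_n)$ whenever $C_n\to C$, and there are $C_n\to C$ with $F_n(C_n)\to F(C)$. Let $k\ge 1$, $\bar x\in\operatorname{int}X$, $\bar x_n\in X$ with $\bar x_n\to\bar x$, and $\mu_n,\mu\in\mathcal P(X)$ with $\mu_n\to\mu$ weakly, and suppose that the affine dimension of $\operatorname{supp}\mu$ is at least $k$. For each $n$ let $\{\bar x_n\}=C_{n,0}\subset C_{n,1}\subset\dots\subset C_{n,k}$ be such that each $C_{n,j}$ is a $(j,\bar x_n,\mu_n)$-nested CPC. Then there are a subsequence $(n')$ and sets $C_0,\dots,C_k\in CL(X)$ such that: 1. For each $j=0,\dots,k$, $C_{n',j}\to C_j$ in Hausdorff distance, and $C_j\in CC_{\bar x,j}(X)$. 2. $C_0\subset C_1\subset\dots\subset C_k$ and each $C_j$ is a $(j,\bar x,\mu)$-nested CPC. If, in addition, $(C_{n',j})_{j\le k}$ is a sequentially optimal chain for $(\bar x_{n'},\mu_{n'})$ for each $n'$, then $(C_j)_{j\le k}$ is a sequentially optimal chain for $(\bar x,\mu)$. 3. For $j=1,\dots,k$ let $\mathfrak C_{n',j}=\{C\in CC_{\bar x_{n'},j}(X):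 C\supset C_{n',j-1}\}$ and $\mathfrak C_j=\{C\in CC_{\bar x,j}(X): C\supset C_{j-1}\}$. Then, along the subsequence, $\chi_{\mathfrak C_{n',j}}$ $\Gamma$-converges to $\chi_{\mathfrak C_j}$; moreover $$\inf_{C\in CL(X)}\{J(C;\mu_{n'})+\chi_{\mathfrak C_{n',j}}(C)\}\longrightarrow\inf_{C\in CL(X)}\{J(C;\mu)+\chi_{\mathfrak C_j}(C)\},$$ and if $D_{n'}$ attains the infimum on the left for every $n'$, then every accumulation point of $(D_{n'})$ in Hausdorff distance attains the infimum on the right. -/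

import Mathlib

open MeasureTheory Filter Topology TopologicalSpace

noncomputable section

namespace ConvexPCA

section Gamma

variable {Y : Type*}

/-- The indicator `χ_A` of variational analysis: `0` on `A` and `+∞` off `A`. -/
def chi (A : Set Y) (y : Y) : EReal :=
  open Classical in if y ∈ A then 0 else ⊤

/-- Sequential `Γ`-convergence of extended real valued functions on a metric space. -/
def GammaTendsto [MetricSpace Y] (F : ℕ → Y → EReal) (G : Y → EReal) : Prop :=
  ∀ y : Y,
    (∀ u : ℕ → Y, Tendsto u atTop (𝓝 y) → G y ≤ liminf (fun n => F n (u n)) atTop) ∧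
    (∃ u : ℕ → Y, Tendsto u atTop (𝓝 y) ∧ Tendsto (fun n => F n (u n)) atTop (𝓝 (G y)))

/-- The set of points at which `F` attains its infimum over the whole space. -/
def argmin (F : Y → EReal) : Set Y := {y | F y = ⨅ z, F z}

end Gamma

variable {H : Type*} [NormedAddCommGroup H] [InnerProductSpace ℝ H]

/-- Affine dimension of a (nonempty) subset of a finite dimensional space. -/
def affineDim [FiniteDimensional ℝ H] (A : Set H) : ℕ :=
  Module.finrank ℝ (vectorSpan ℝ A)

/-- `CL(X)` for a compact set `X`: the nonempty closed (equivalently, since `X` is compact,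
nonempty compact) subsets of `X`. It carries the Hausdorff distance, which is Mathlib's metric on
`NonemptyCompacts H`. -/
abbrev CL (X : Set H) : Type _ := {C : NonemptyCompacts H // (C : Set H) ⊆ X}

/-- `CC_{x,k}(X)`: the convex members of `CL(X)` of affine dimension at most `k` that contain the
reference point `x`. -/
def CC [FiniteDimensional ℝ H] {X : Set H} (x : X) (k : ℕ) : Set (CL X) :=
  {C | Convex ℝ (C.1 : Set H) ∧ affineDim (C.1 : Set H) ≤ k ∧ (x : H) ∈ (C.1 : Set H)}

/-- The constraint family `{C ∈ CC_{x,k}(X) : C ⊇ B}` of the nested problem. -/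
def nestedFamily [FiniteDimensional ℝ H] {X : Set H} (x : X) (k : ℕ) (B : CL X) : Set (CL X) :=
  {C | C ∈ CC x k ∧ (B.1 : Set H) ⊆ (C.1 : Set H)}

variable [MeasurableSpace H] [BorelSpace H]

/-- `J(C; μ) = E_μ[d(x, C)²]`. -/
def J {X : Set H} (C : CL X) (μ : ProbabilityMeasure X) : ℝ :=
  ∫ y : X, (Metric.infDist (y : H) (C.1 : Set H)) ^ 2 ∂(μ : Measure X)

/-- The unconstrained form `C ↦ J(C; μ) + χ_A(C)` of the problem of minimizing `J(·; μ)`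
over `A`. -/
def penalizedJ {X : Set H} (μ : ProbabilityMeasure X) (A : Set (CL X)) (C : CL X) : EReal :=
  (J C μ : EReal) + chi A C

/-- `C 0 = {x}` and, for `ℓ = 1, …, k`, the set `C ℓ` minimizes `J(·; μ)` over the members of
`CC_{x,ℓ}(X)` that contain `C (ℓ - 1)`. Only the values `C 0, …, C k` matter. -/
def IsNestedChain [FiniteDimensional ℝ H] {X : Set H} (x : X) (μ : ProbabilityMeasure X) (k : ℕ)
    (C : ℕ → CL X) : Prop :=
  ((C 0).1 : Set H) = {(x : H)} ∧
    ∀ l, l < k → C (l + 1) ∈ nestedFamily x (l + 1) (C l) ∧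
      ∀ D ∈ nestedFamily x (l + 1) (C l), J (C (l + 1)) μ ≤ J D μ

/-- `B` is a `(k, x, μ)`-nested convex principal component: it is the last set of some chain of
length `k` as above. For `k = 0` this says `B = {x}`. -/
def IsNestedCPC [FiniteDimensional ℝ H] {X : Set H} (x : X) (μ : ProbabilityMeasure X) (k : ℕ)
    (B : CL X) : Prop :=
  ∃ C : ℕ → CL X, IsNestedChain x μ k C ∧ C k = B

end ConvexPCA

end

open ConvexPCA

/-!
The sets `CL X` form a compact metric space, so along a subsequence all the `C_{n,j}` converge to
sets `C_j`. Everything else follows from Γ-convergence of the constrained problems: on a compact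
space it gives convergence of the infima (`GammaTendsto.tendsto_iInf`) and optimality of the cluster
points of minimizers (`GammaTendsto.mem_argmin`). Since `J` is continuous in the set and the measure
jointly (`tendsto_J`), only the constraint indicators have to be shown to Γ-converge, that is, the
constraint families have to converge in the sense of Kuratowski.

Limits of admissible sets are admissible (`mem_nestedFamily_of_frequently`): convexity and inclusion
pass to Hausdorff limits, and the dimension is lower semicontinuous because linear independence is
an open condition.

The converse approximation (`eventually_exists_mem_nestedFamily_dist_le`) is the crux. Let `E ⊇ C_j`
be admissible for the limit problem; sets `D_n ⊇ C_{n,j}` of dimension at most `j + 1` close to `E`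
are needed. If `C_j` had dimension less than `j`, the directions of the `C_{n,j}` could converge to
a subspace unrelated to `E`, and such `D_n` need not exist. If `C_j` has dimension exactly `j`,
perturbing a basis of its direction produces linear maps `A_n → id` that carry the direction of
`C_j` onto that of `C_{n,j}`, and `D_n` can be taken to be the convex hull of `C_{n,j}` and a
slightly shrunk copy of the image of `E` under `A_n`. The shrinking, towards the interior point
`xbar` of `X`, keeps `D_n` inside `X`.

The dimension is maximal because of optimality (`affineDim_eq_of_minimizer`): as the support of `μ`
has dimension at least `k`, a set of dimension less than `j + 1 ≤ k` misses a point of the support,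
and its convex hull with that point is admissible and has strictly smaller risk. Optimality of the
limit sets and maximality of their dimension are therefore proved together, by induction along the
chain (`isNestedChain_of_tendsto`).
-/

open ConvexPCA

namespace ConvexPCA

/-! ### Γ-convergence on a compact metric space -/

section Gamma

variable {Y : Type*}

theorem chi_of_mem {A : Set Y} {y : Y} (h : y ∈ A) : chi A y = 0 := if_pos h

theorem chi_of_notMem {A : Set Y} {y : Y} (h : y ∉ A) : chi A y = ⊤ := if_neg h

variable [MetricSpace Y] {F : ℕ → Y → EReal} {G : Y → EReal}

/-- The lower bound in Γ-convergence also holds along sequences indexed by a subsequence, because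
such a sequence extends to a full one by inserting its limit. -/
theorem GammaTendsto.le_liminf_subseq (h : GammaTendsto F G) {ψ : ℕ → ℕ} (hψ : StrictMono ψ)
    {u : ℕ → Y} {y : Y} (hu : Tendsto u atTop (𝓝 y)) :
    G y ≤ liminf (fun i => F (ψ i) (u i)) atTop := by
  set v : ℕ → Y := Function.extend ψ u (fun _ => y) with hvdef
  have hvψ : ∀ i, v (ψ i) = u i := fun i => hψ.injective.extend_apply _ _ _
  have hv : Tendsto v atTop (𝓝 y) := by
    refine tendsto_atTop'.2 fun s hs => ?_
    obtain ⟨N, hN⟩ := tendsto_atTop'.1 hu s hs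
    refine ⟨ψ N, fun n hn => ?_⟩
    by_cases hex : ∃ i, ψ i = n
    · obtain ⟨i, rfl⟩ := hex
      rw [hvψ]
      exact hN i (hψ.le_iff_le.1 hn)
    · rw [hvdef, Function.extend_apply' _ _ _ hex]
      exact mem_of_mem_nhds hs
  calc G y ≤ liminf (fun n => F n (v n)) atTop := (h y).1 v hv
    _ ≤ liminf (fun n => F n (v n)) (map ψ atTop) := liminf_le_liminf_of_le hψ.tendsto_atTop
    _ = liminf (fun i => F (ψ i) (u i)) atTop := by
      rw [← liminf_comp]
      simp only [Function.comp_def, hvψ]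

/-- Convergence of infima under Γ-convergence on a compact space. -/
theorem GammaTendsto.tendsto_iInf [CompactSpace Y] (h : GammaTendsto F G) :
    Tendsto (fun n => ⨅ y, F n y) atTop (𝓝 (⨅ y, G y)) := by
  refine tendsto_order.2 ⟨fun a ha => ?_, fun a ha => ?_⟩
  · by_contra hcon
    obtain ⟨b, hab, hb⟩ := exists_between ha
    have hfreq : ∃ᶠ n in atTop, ∃ y, F n y < b := by
      refine (not_eventually.1 hcon).mono fun n hn => ?_
      exact iInf_lt_iff.1 ((not_lt.1 hn).trans_lt hab)
    obtain ⟨φ, hφ, hD⟩ := extraction_of_frequently_atTop hfreq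
    choose D hD using hD
    obtain ⟨y, θ, hθ, hy⟩ := CompactSpace.tendsto_subseq D
    have h1 := h.le_liminf_subseq (hφ.comp hθ) hy
    have h2 : liminf (fun i => F ((φ ∘ θ) i) ((D ∘ θ) i)) atTop ≤ b :=
      liminf_le_of_frequently_le' (Eventually.of_forall fun i => (hD (θ i)).le).frequently
    exact absurd ((hb.trans_le (iInf_le _ y)).trans_le (h1.trans h2)) (lt_irrefl _)
  · obtain ⟨y, hy⟩ := iInf_lt_iff.1 ha
    obtain ⟨u, -, hu⟩ := (h y).2
    filter_upwards [hu.eventually_lt_const hy] with n hn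
    exact (iInf_le _ _).trans_lt hn

/-- Cluster points of minimizers of a Γ-convergent sequence minimize the limit. -/
theorem GammaTendsto.mem_argmin [CompactSpace Y] (h : GammaTendsto F G) {u : ℕ → Y}
    (hu : ∀ n, u n ∈ argmin (F n)) {y : Y} (hy : MapClusterPt y atTop u) : y ∈ argmin G := by
  obtain ⟨ψ, hψ, hlim⟩ := hy.tendsto_subseq
  have h1 := h.le_liminf_subseq hψ hlim
  have h2 : Tendsto (fun i => F (ψ i) ((u ∘ ψ) i)) atTop (𝓝 (⨅ z, G z)) := by
    have h3 : ∀ i, F (ψ i) ((u ∘ ψ) i) = ⨅ z, F (ψ i) z := fun i => hu (ψ i)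
    simp only [h3]
    exact h.tendsto_iInf.comp hψ.tendsto_atTop
  rw [h2.liminf_eq] at h1
  exact le_antisymm h1 (iInf_le _ y)

/-- Kuratowski convergence of sets yields Γ-convergence of their indicators. -/
theorem gammaTendsto_chi {A : ℕ → Set Y} {B : Set Y}
    (hclosed : ∀ (u : ℕ → Y) (y : Y), Tendsto u atTop (𝓝 y) → (∃ᶠ n in atTop, u n ∈ A n) → y ∈ B)
    (hrec : ∀ y ∈ B, ∃ u : ℕ → Y, Tendsto u atTop (𝓝 y) ∧ ∀ n, u n ∈ A n) :
    GammaTendsto (fun n => chi (A n)) (chi B) := by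
  have hoff : ∀ (u : ℕ → Y) (y : Y), Tendsto u atTop (𝓝 y) → y ∉ B →
      Tendsto (fun n => chi (A n) (u n)) atTop (𝓝 ⊤) := by
    intro u y hu hy
    refine tendsto_const_nhds.congr' ?_
    filter_upwards [not_frequently.1 (mt (hclosed u y hu) hy)] with n hn
    exact (chi_of_notMem hn).symm
  intro y
  by_cases hy : y ∈ B
  · refine ⟨fun u _ => ?_, ?_⟩
    · rw [chi_of_mem hy]
      refine le_liminf_of_le (by isBoundedDefault) (Eventually.of_forall fun n => ?_)
      change 0 ≤ chi (A n) (u n)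
      by_cases hn : u n ∈ A n
      · rw [chi_of_mem hn]
      · rw [chi_of_notMem hn]; exact le_top
    · obtain ⟨u, hu, huA⟩ := hrec y hy
      refine ⟨u, hu, ?_⟩
      simp only [chi_of_mem hy, chi_of_mem (huA _)]
      exact tendsto_const_nhds
  · rw [chi_of_notMem hy]
    exact ⟨fun u hu => (hoff u y hu hy).liminf_eq.ge,
      fun _ => y, tendsto_const_nhds, hoff _ y tendsto_const_nhds hy⟩

/-- Γ-convergence is stable under adding real functions that converge continuously. -/
theorem GammaTendsto.coe_add (h : GammaTendsto F G) {f : ℕ → Y → ℝ} {g : Y → ℝ}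
    (hf : ∀ (u : ℕ → Y) (y : Y), Tendsto u atTop (𝓝 y) →
      Tendsto (fun n => f n (u n)) atTop (𝓝 (g y))) :
    GammaTendsto (fun n y => (f n y : EReal) + F n y) (fun y => (g y : EReal) + G y) := by
  intro y
  refine ⟨fun u hu => ?_, ?_⟩
  · have h1 := EReal.tendsto_coe.2 (hf u y hu)
    calc (g y : EReal) + G y
        ≤ liminf (fun n => (f n (u n) : EReal)) atTop + liminf (fun n => F n (u n)) atTop := by
          rw [h1.liminf_eq]
          exact add_le_add_right ((h y).1 u hu) _
      _ ≤ _ := EReal.le_liminf_add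
  · obtain ⟨u, hu, hF⟩ := (h y).2
    exact ⟨u, hu, (EReal.continuousAt_add (p := ((g y : EReal), G y)) (.inl (EReal.coe_ne_top _))
      (.inl (EReal.coe_ne_bot _))).tendsto.comp
        ((EReal.tendsto_coe.2 (hf u y hu)).prodMk_nhds hF)⟩

end Gamma

/-! ### Hausdorff limits of compact sets -/

section Hausdorff

theorem compactSpace_CL {H : Type*} [NormedAddCommGroup H] {X : Set H} (hX : IsCompact X) :
    CompactSpace (CL X) :=
  isCompact_iff_compactSpace.1 (NonemptyCompacts.isCompact_subsets_of_isCompact hX)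

variable {M : Type*} [MetricSpace M] {D : ℕ → NonemptyCompacts M} {E : NonemptyCompacts M}

theorem mem_of_tendsto_of_mem (hD : Tendsto D atTop (𝓝 E)) {y : ℕ → M} {z : M}
    (hy : Tendsto y atTop (𝓝 z)) (hmem : ∀ n, y n ∈ (D n : Set M)) : z ∈ (E : Set M) := by
  have h1 : Tendsto (fun n => Metric.infDist z (D n : Set M)) atTop
      (𝓝 (Metric.infDist z (E : Set M))) :=
    ((Metric.lipschitz_infDist_set z).continuous.tendsto E).comp hD
  have h2 : Tendsto (fun n => Metric.infDist z (D n : Set M)) atTop (𝓝 0) := by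
    refine squeeze_zero (fun _ => Metric.infDist_nonneg)
      (fun n => Metric.infDist_le_dist_of_mem (hmem n)) ?_
    simpa only [dist_comm z] using tendsto_iff_dist_tendsto_zero.1 hy
  exact (E.isCompact.isClosed.mem_iff_infDist_zero E.nonempty).2 (tendsto_nhds_unique h1 h2)

theorem exists_tendsto_of_mem (hD : Tendsto D atTop (𝓝 E)) {z : M} (hz : z ∈ (E : Set M)) :
    ∃ y : ℕ → M, (∀ n, y n ∈ (D n : Set M)) ∧ Tendsto y atTop (𝓝 z) := by
  choose y hy hdist using fun n => (D n).isCompact.exists_infDist_eq_dist (D n).nonempty z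
  refine ⟨y, hy, tendsto_iff_dist_tendsto_zero.2 ?_⟩
  have h1 : Tendsto (fun n => Metric.infDist z (D n : Set M)) atTop
      (𝓝 (Metric.infDist z (E : Set M))) :=
    ((Metric.lipschitz_infDist_set z).continuous.tendsto E).comp hD
  rw [Metric.infDist_zero_of_mem hz] at h1
  simpa only [hdist, dist_comm z] using h1

/-- If a point can be approximated within each `ε` by members of `S n` for all large `n`, then it
is the limit of a single sequence of members. -/
theorem exists_tendsto_of_eventually_dist_le {S : ℕ → Set M} (hne : ∀ n, (S n).Nonempty) {z : M}
    (h : ∀ ε > 0, ∀ᶠ n in atTop, ∃ y ∈ S n, dist z y ≤ ε) :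
    ∃ u : ℕ → M, Tendsto u atTop (𝓝 z) ∧ ∀ n, u n ∈ S n := by
  have hpos : ∀ n : ℕ, (0 : ℝ) < 1 / ((n : ℝ) + 1) := fun n => Nat.one_div_pos_of_nat
  choose u hu hdist using fun n => (Metric.infDist_lt_iff (hne n)).1
    (lt_add_of_pos_right (Metric.infDist z (S n)) (hpos n))
  have hinf : Tendsto (fun n => Metric.infDist z (S n)) atTop (𝓝 0) := by
    refine tendsto_order.2 ⟨fun a ha => Eventually.of_forall fun n =>
      ha.trans_le Metric.infDist_nonneg, fun a ha => ?_⟩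
    filter_upwards [h (a / 2) (half_pos ha)] with n hn
    obtain ⟨y, hy, hle⟩ := hn
    exact ((Metric.infDist_le_dist_of_mem hy).trans hle).trans_lt (half_lt_self ha)
  refine ⟨u, tendsto_iff_dist_tendsto_zero.2 ?_, hu⟩
  refine squeeze_zero (fun _ => dist_nonneg) (fun n => ?_)
    (by simpa only [add_zero] using hinf.add tendsto_one_div_add_atTop_nhds_zero_nat)
  rw [dist_comm]
  exact (hdist n).le

end Hausdorff

section Limits

variable {H : Type*} [NormedAddCommGroup H] [InnerProductSpace ℝ H]

theorem convex_of_tendsto {D : ℕ → NonemptyCompacts H} {E : NonemptyCompacts H}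
    (hD : Tendsto D atTop (𝓝 E)) (hconv : ∀ n, Convex ℝ (D n : Set H)) :
    Convex ℝ (E : Set H) := by
  intro p hp q hq a b ha hb hab
  obtain ⟨u, hu, hup⟩ := exists_tendsto_of_mem hD hp
  obtain ⟨v, hv, hvq⟩ := exists_tendsto_of_mem hD hq
  exact mem_of_tendsto_of_mem hD ((hup.const_smul a).add (hvq.const_smul b))
    fun n => hconv n (hu n) (hv n) ha hb hab

variable [FiniteDimensional ℝ H]

/-- A set contains as many linearly independent differences, taken from any of its points, as its
affine dimension. -/
theorem exists_linearIndependent_sub {A : Set H} {p : H} (hp : p ∈ A) {m : ℕ}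
    (hm : affineDim A = m) :
    ∃ c : Fin m → H, (∀ i, c i ∈ A) ∧ LinearIndependent ℝ (fun i => c i - p) ∧
      Submodule.span ℝ (Set.range fun i => c i - p) = vectorSpan ℝ A := by
  subst hm
  unfold affineDim
  rw [vectorSpan_eq_span_vsub_set_right ℝ hp]
  obtain ⟨f, hf, hspan, hli⟩ :=
    Submodule.exists_fun_fin_finrank_span_eq ℝ ((fun q => q -ᵥ p) '' A)
  choose c hc hcf using hf
  have hcf' : (fun i => c i - p) = f := funext hcf
  exact ⟨c, hc, by rwa [hcf'], by rw [hcf', hspan]⟩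

/-- Linearly independent differences within a set bound its affine dimension from below, and span
its direction if there are enough of them. -/
theorem le_affineDim_of_linearIndependent_sub {A : Set H} {p : H} (hp : p ∈ A) {m : ℕ}
    {c : Fin m → H} (hc : ∀ i, c i ∈ A) (hli : LinearIndependent ℝ (fun i => c i - p)) :
    m ≤ affineDim A ∧ (affineDim A ≤ m →
      vectorSpan ℝ A = Submodule.span ℝ (Set.range fun i => c i - p)) := by
  have hle : Submodule.span ℝ (Set.range fun i => c i - p) ≤ vectorSpan ℝ A := by
    refine Submodule.span_le.2 ?_
    rintro _ ⟨i, rfl⟩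
    exact vsub_mem_vectorSpan ℝ (hc i) hp
  have hcard := finrank_span_eq_card hli
  rw [Fintype.card_fin] at hcard
  refine ⟨hcard ▸ Submodule.finrank_mono hle, fun h => ?_⟩
  exact (Submodule.eq_of_le_of_finrank_le hle (hcard.symm ▸ h)).symm

/-- The affine dimension is lower semicontinuous for the Hausdorff distance, because linear
independence is an open condition. -/
theorem affineDim_le_of_tendsto {D : ℕ → NonemptyCompacts H} {E : NonemptyCompacts H}
    (hD : Tendsto D atTop (𝓝 E)) {m : ℕ} (hdim : ∀ n, affineDim (D n : Set H) ≤ m) :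
    affineDim (E : Set H) ≤ m := by
  obtain ⟨p, hp⟩ := E.nonempty
  obtain ⟨c, hc, hli, -⟩ := exists_linearIndependent_sub hp rfl
  obtain ⟨q, hq, hqp⟩ := exists_tendsto_of_mem hD hp
  choose d hd hdc using fun i => exists_tendsto_of_mem hD (hc i)
  have hlim : Tendsto (fun n i => d i n - q n) atTop (𝓝 fun i => c i - p) :=
    tendsto_pi_nhds.2 fun i => (hdc i).sub hqp
  obtain ⟨n, hn⟩ := (hlim.eventually hli.eventually).exists
  exact (le_affineDim_of_linearIndependent_sub (hq n) (fun i => hd i n) hn).1.trans (hdim n)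

/-- The nested constraints are closed under joint convergence of the reference points, the
prescribed subsets and the competitors. -/
theorem mem_nestedFamily_of_frequently {X : Set H} {x : ℕ → X} {xbar : X}
    (hx : Tendsto x atTop (𝓝 xbar)) {B D : ℕ → CL X} {Bbar E : CL X}
    (hB : Tendsto B atTop (𝓝 Bbar)) (hD : Tendsto D atTop (𝓝 E)) {m : ℕ}
    (hmem : ∃ᶠ n in atTop, D n ∈ nestedFamily (x n) m (B n)) : E ∈ nestedFamily xbar m Bbar := by
  obtain ⟨φ, hφ, hφmem⟩ := extraction_of_frequently_atTop hmem
  have hx' : Tendsto (fun i => (x (φ i) : H)) atTop (𝓝 (xbar : H)) :=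
    (continuous_subtype_val.tendsto _).comp (hx.comp hφ.tendsto_atTop)
  have hB' : Tendsto (fun i => (B (φ i)).1) atTop (𝓝 Bbar.1) :=
    (continuous_subtype_val.tendsto _).comp (hB.comp hφ.tendsto_atTop)
  have hD' : Tendsto (fun i => (D (φ i)).1) atTop (𝓝 E.1) :=
    (continuous_subtype_val.tendsto _).comp (hD.comp hφ.tendsto_atTop)
  refine ⟨⟨convex_of_tendsto hD' fun i => (hφmem i).1.1,
    affineDim_le_of_tendsto hD' fun i => (hφmem i).1.2.1,
    mem_of_tendsto_of_mem hD' hx' fun i => (hφmem i).1.2.2⟩, fun b hb => ?_⟩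
  obtain ⟨u, hu, hub⟩ := exists_tendsto_of_mem hB' hb
  exact mem_of_tendsto_of_mem hD' hub fun i => (hφmem i).2 (hu i)

end Limits

/-! ### Continuity of the risk -/

section Risk

variable {H : Type*} [NormedAddCommGroup H] {X : Set H}

/-- The integrand `y ↦ d(y, C)²` of `J`, as a bounded continuous function on the compact set `X`. -/
noncomputable def distSq [CompactSpace X] (C : CL X) : BoundedContinuousFunction X ℝ :=
  BoundedContinuousFunction.mkOfCompact
    ⟨fun y : X => (Metric.infDist (y : H) (C.1 : Set H)) ^ 2,
      ((Metric.continuous_infDist_pt _).comp continuous_subtype_val).pow 2⟩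

@[simp]
theorem distSq_apply [CompactSpace X] (C : CL X) (y : X) :
    distSq C y = (Metric.infDist (y : H) (C.1 : Set H)) ^ 2 := rfl

theorem infDist_le_diam (hX : IsCompact X) (C : CL X) (y : X) :
    Metric.infDist (y : H) (C.1 : Set H) ≤ Metric.diam X := by
  obtain ⟨c, hc⟩ := C.1.nonempty
  exact (Metric.infDist_le_dist_of_mem hc).trans
    (Metric.dist_le_diam_of_mem hX.isBounded y.2 (C.2 hc))

theorem abs_distSq_sub_le (hX : IsCompact X) [CompactSpace X] (C E : CL X) (y : X) :
    |distSq C y - distSq E y| ≤ dist C E * (2 * Metric.diam X) := by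
  have h1 : |Metric.infDist (y : H) (C.1 : Set H) - Metric.infDist (y : H) (E.1 : Set H)|
      ≤ dist C E := by
    simpa [Real.dist_eq, Subtype.dist_eq] using
      (Metric.lipschitz_infDist_set (y : H)).dist_le_mul C.1 E.1
  have hC := infDist_le_diam hX C y
  have hE := infDist_le_diam hX E y
  have hC0 : 0 ≤ Metric.infDist (y : H) (C.1 : Set H) := Metric.infDist_nonneg
  have hE0 : 0 ≤ Metric.infDist (y : H) (E.1 : Set H) := Metric.infDist_nonneg
  rw [distSq_apply, distSq_apply, sq_sub_sq, mul_comm, abs_mul]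
  refine mul_le_mul h1 ?_ (abs_nonneg _) dist_nonneg
  rw [abs_of_nonneg (by positivity)]
  linarith

variable [MeasurableSpace H]

theorem J_eq_integral_distSq [CompactSpace X] (C : CL X) (ν : ProbabilityMeasure X) :
    J C ν = ∫ y, distSq C y ∂(ν : Measure X) := rfl

/-- The risk `J` is sequentially continuous in the set and the measure jointly. -/
theorem tendsto_J [BorelSpace H] (hX : IsCompact X) {C : ℕ → CL X} {E : CL X}
    (hC : Tendsto C atTop (𝓝 E))
    {ν : ℕ → ProbabilityMeasure X} {μ : ProbabilityMeasure X} (hν : Tendsto ν atTop (𝓝 μ)) :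
    Tendsto (fun n => J (C n) (ν n)) atTop (𝓝 (J E μ)) := by
  have : CompactSpace X := isCompact_iff_compactSpace.1 hX
  have h1 : Tendsto (fun n => J E (ν n)) atTop (𝓝 (J E μ)) :=
    ProbabilityMeasure.tendsto_iff_forall_integral_tendsto.1 hν (distSq E)
  have h2 : Tendsto (fun n => J (C n) (ν n) - J E (ν n)) atTop (𝓝 0) := by
    refine squeeze_zero_norm (a := fun n => dist (C n) E * (2 * Metric.diam X)) (fun n => ?_) ?_
    · rw [J_eq_integral_distSq, J_eq_integral_distSq,
        ← integral_sub ((distSq _).integrable _) ((distSq _).integrable _)]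
      refine (norm_integral_le_of_norm_le_const
        (Eventually.of_forall fun y => abs_distSq_sub_le hX (C n) E y)).trans ?_
      simp
    · simpa using (tendsto_iff_dist_tendsto_zero.1 hC).mul_const (2 * Metric.diam X)
  simpa using h2.add h1

end Risk

/-! ### Recovery of competitors -/

section Recovery

variable {H : Type*} [NormedAddCommGroup H] [InnerProductSpace ℝ H]

theorem isCompact_convexHull_union {S T : Set H} (hS : IsCompact S) (hT : IsCompact T)
    (hSc : Convex ℝ S) (hTc : Convex ℝ T) (hSne : S.Nonempty) (hTne : T.Nonempty) :
    IsCompact (convexHull ℝ (S ∪ T)) := by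
  have himage : convexHull ℝ (S ∪ T) =
      (fun q : ℝ × H × H => (1 - q.1) • q.2.1 + q.1 • q.2.2) '' (Set.Icc 0 1 ×ˢ S ×ˢ T) := by
    rw [hSc.convexHull_union hTc hSne hTne]
    ext e
    simp only [mem_convexJoin, segment_eq_image, Set.mem_image, Set.mem_prod, Prod.exists]
    constructor
    · rintro ⟨a, ha, b, hb, t, ht, rfl⟩
      exact ⟨t, a, b, ⟨ht, ha, hb⟩, rfl⟩
    · rintro ⟨t, a, b, ⟨ht, ha, hb⟩, rfl⟩
      exact ⟨a, ha, b, hb, t, ht, rfl⟩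
  rw [himage]
  exact (isCompact_Icc.prod (hS.prod hT)).image (by fun_prop)

variable [FiniteDimensional ℝ H]

/-- A small perturbation of a linearly independent family is its image under a linear map close to
the identity. -/
theorem exists_tendsto_id_apply_eq {m : ℕ} {b : Fin m → H} (hb : LinearIndependent ℝ b)
    {c : ℕ → Fin m → H} (hc : ∀ i, Tendsto (fun n => c n i) atTop (𝓝 (b i))) :
    ∃ A : ℕ → H →L[ℝ] H, Tendsto A atTop (𝓝 (ContinuousLinearMap.id ℝ H)) ∧
      ∀ n i, A n (b i) = c n i := by
  obtain ⟨g, hg⟩ := LinearMap.exists_leftInverse_of_injective (Fintype.linearCombination ℝ b)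
    (LinearMap.ker_eq_bot.2 hb.fintypeLinearCombination_injective)
  -- `φ i` is a dual functional: `φ i (b j)` is `1` for `j = i` and `0` otherwise
  let φ : Fin m → H →L[ℝ] ℝ := fun i => LinearMap.toContinuousLinearMap (LinearMap.proj i ∘ₗ g)
  have hφ : ∀ i j, φ i (b j) = (Pi.single j 1 : Fin m → ℝ) i := by
    intro i j
    have h := LinearMap.congr_fun hg (Pi.single j 1)
    simp only [LinearMap.comp_apply, Fintype.linearCombination_apply_single, one_smul,
      LinearMap.id_apply] at h
    exact congr_fun h i
  refine ⟨fun n => ContinuousLinearMap.id ℝ H + ∑ i, (φ i).smulRight (c n i - b i), ?_, ?_⟩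
  · have h0 : Tendsto (fun n => ∑ i, (φ i).smulRight (c n i - b i)) atTop
        (𝓝 (∑ i, (φ i).smulRight (b i - b i))) :=
      tendsto_finsetSum _ fun i _ =>
        ((ContinuousLinearMap.smulRightL ℝ H H (φ i)).continuous.tendsto _).comp
          ((hc i).sub_const (b i))
    simpa using h0.const_add (ContinuousLinearMap.id ℝ H)
  · intro n j
    simp [hφ, Pi.single_apply]

/-- A competitor of the limit problem is approximated by competitors of the perturbed problems.
The dimension of the limit `Bbar` has to be the maximal one: then the direction of `B n` is the
image of the direction of `Bbar` under a linear map `A n` close to the identity, and `A n` carries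
the direction of `E` to a subspace that contains the direction of `B n`. The competitor is the
convex hull of `B n` and the image of `E`, the latter shrunk towards the interior point `xbar` so
that it stays inside `X`. -/
theorem eventually_exists_mem_nestedFamily_dist_le {X : Set H} (hXconv : Convex ℝ X)
    {x : ℕ → X} {xbar : X} (hxbar : (xbar : H) ∈ interior X) (hx : Tendsto x atTop (𝓝 xbar))
    {m : ℕ} {B : ℕ → CL X} {Bbar : CL X} (hBmem : ∀ n, B n ∈ CC (x n) m)
    (hB : Tendsto B atTop (𝓝 Bbar)) (hxB : (xbar : H) ∈ (Bbar.1 : Set H))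
    (hdim : affineDim (Bbar.1 : Set H) = m) {E : CL X} (hE : E ∈ nestedFamily xbar (m + 1) Bbar)
    {ε : ℝ} (hε : 0 < ε) :
    ∀ᶠ n in atTop, ∃ D ∈ nestedFamily (x n) (m + 1) (B n), dist E D ≤ ε := by
  obtain ⟨⟨hEconv, hEdim, hxE⟩, hBE⟩ := hE
  have hx' : Tendsto (fun n => (x n : H)) atTop (𝓝 (xbar : H)) :=
    (continuous_subtype_val.tendsto _).comp hx
  have hB' : Tendsto (fun n => (B n).1) atTop (𝓝 Bbar.1) :=
    (continuous_subtype_val.tendsto _).comp hB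
  obtain ⟨c, hc, hli, hspan⟩ := exists_linearIndependent_sub hxB hdim
  choose d hd hdc using fun i => exists_tendsto_of_mem hB' (hc i)
  obtain ⟨A, hA, hAb⟩ := exists_tendsto_id_apply_eq hli (c := fun n i => d i n - x n)
    fun i => (hdc i).sub hx'
  obtain ⟨r, hr, hrX⟩ := Metric.nhds_basis_closedBall.mem_iff.1 (mem_interior_iff_mem_nhds.1 hxbar)
  obtain ⟨R, hR, hER⟩ := E.1.isCompact.isBounded.subset_closedBall_lt 0 (xbar : H)
  have hER' : ∀ e ∈ (E.1 : Set H), ‖e - xbar‖ ≤ R := fun e he => mem_closedBall_iff_norm.1 (hER he)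
  -- shrinking `E` by the factor `1 - t` moves its points by at most `t * R ≤ ε / 2`
  obtain ⟨t, ht0, ht1, htR⟩ : ∃ t : ℝ, 0 < t ∧ t ≤ 1 ∧ t * R ≤ ε / 2 := by
    refine ⟨min 1 (ε / 2 / R), lt_min one_pos (by positivity), min_le_left _ _, ?_⟩
    calc min 1 (ε / 2 / R) * R ≤ ε / 2 / R * R := by gcongr; exact min_le_right _ _
      _ = ε / 2 := div_mul_cancel₀ _ hR.ne'
  have hsmall : Tendsto (fun n => ‖(x n : H) - xbar‖ + ‖A n - ContinuousLinearMap.id ℝ H‖ * R) atTop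
      (𝓝 0) := by
    simpa using (tendsto_iff_norm_sub_tendsto_zero.1 hx').add
      ((tendsto_iff_norm_sub_tendsto_zero.1 hA).mul_const R)
  have hlim : Tendsto (fun n i => d i n - (x n : H)) atTop (𝓝 fun i => c i - (xbar : H)) :=
    tendsto_pi_nhds.2 fun i => (hdc i).sub hx'
  filter_upwards [hsmall.eventually_le_const (lt_min (mul_pos ht0 hr) (half_pos hε)),
    hlim.eventually hli.eventually, (tendsto_iff_dist_tendsto_zero.1 hB).eventually_le_const hε]
    with n hn hnli hnB
  obtain ⟨hBconv, hBdim, hxB'⟩ := hBmem n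
  set p : H → H := fun e => (x n : H) + (1 - t) • A n (e - xbar) with hp
  have hpcont : Continuous p := by fun_prop
  -- `q e` is the displacement of `p e` from the shrunk point `(1 - t) • e + t • xbar`
  set q : H → H := fun e => p e - ((1 - t) • e + t • (xbar : H)) with hq
  have hqle : ∀ e ∈ (E.1 : Set H), ‖q e‖ ≤ min (t * r) (ε / 2) := by
    intro e he
    have hqe : q e = ((x n : H) - xbar) +
        (1 - t) • (A n - ContinuousLinearMap.id ℝ H) (e - xbar) := by
      simp only [hq, hp, sub_apply, ContinuousLinearMap.id_apply]
      module
    refine le_trans ?_ hn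
    rw [hqe]
    refine (norm_add_le _ _).trans (add_le_add_right ?_ _)
    rw [norm_smul, Real.norm_of_nonneg (by linarith)]
    calc (1 - t) * ‖(A n - ContinuousLinearMap.id ℝ H) (e - xbar)‖
        ≤ 1 * (‖A n - ContinuousLinearMap.id ℝ H‖ * R) := by
          gcongr
          · linarith
          · exact (ContinuousLinearMap.le_opNorm _ _).trans (by gcongr; exact hER' e he)
      _ = _ := one_mul _
  have hpX : ∀ e ∈ (E.1 : Set H), p e ∈ X := by
    intro e he
    have hz : (xbar : H) + t⁻¹ • q e ∈ X := by
      refine hrX (mem_closedBall_iff_norm.2 ?_)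
      rw [add_sub_cancel_left, norm_smul, norm_inv, Real.norm_of_nonneg ht0.le,
        inv_mul_le_iff₀ ht0]
      exact (hqle e he).trans (min_le_left _ _)
    have hpe : p e = (1 - t) • e + t • ((xbar : H) + t⁻¹ • q e) := by
      rw [smul_add, smul_inv_smul₀ ht0.ne', hq]
      module
    rw [hpe]
    exact hXconv (E.2 he) hz (by linarith) ht0.le (by ring)
  have hpdist : ∀ e ∈ (E.1 : Set H), dist (p e) e ≤ ε := by
    intro e he
    have hpe : p e - e = q e - t • (e - xbar) := by
      simp only [hq]
      module
    rw [dist_eq_norm, hpe]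
    refine (norm_sub_le _ _).trans ?_
    rw [norm_smul, Real.norm_of_nonneg ht0.le]
    have h1 := (hqle e he).trans (min_le_right _ _)
    have h2 := mul_le_mul_of_nonneg_left (hER' e he) ht0.le
    linarith
  set S : Set H := p '' (E.1 : Set H) with hS
  have hSconv : Convex ℝ S := by
    rintro _ ⟨e, he, rfl⟩ _ ⟨f, hf, rfl⟩ a b ha hb hab
    refine ⟨a • e + b • f, hEconv he hf ha hb hab, ?_⟩
    obtain rfl : b = 1 - a := by linarith
    simp only [hp, map_sub, map_add, map_smul]
    module
  have hSne : S.Nonempty := E.1.nonempty.image p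
  have hScomp : IsCompact S := E.1.isCompact.image hpcont
  let K : NonemptyCompacts H :=
    ⟨⟨convexHull ℝ (S ∪ (B n).1),
      isCompact_convexHull_union hScomp (B n).1.isCompact hSconv hBconv hSne (B n).1.nonempty⟩,
      (hSne.mono Set.subset_union_left).convexHull⟩
  have hKX : (K : Set H) ⊆ X := by
    refine convexHull_min (Set.union_subset ?_ (B n).2) hXconv
    rintro _ ⟨e, he, rfl⟩
    exact hpX e he
  have hBK : ((B n).1 : Set H) ⊆ (K : Set H) := Set.subset_union_right.trans (subset_convexHull ℝ _)
  have hSK : S ⊆ (K : Set H) := Set.subset_union_left.trans (subset_convexHull ℝ _)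
  -- the hull stays in the translate by `x n` of the image of the direction of `E`
  have hKdim : affineDim (K : Set H) ≤ m + 1 := by
    have hsub : S ∪ ((B n).1 : Set H) ⊆ AffineSubspace.mk' (x n : H)
        ((vectorSpan ℝ (E.1 : Set H)).map (A n : H →ₗ[ℝ] H)) := by
      rintro z (⟨e, he, rfl⟩ | hz)
      · refine AffineSubspace.mem_mk'.2 ?_
        have hpe : p e -ᵥ (x n : H) = (1 - t) • A n (e - xbar) := by
          simp [hp]
        rw [hpe]
        exact Submodule.smul_mem _ _ (Submodule.mem_map_of_mem (vsub_mem_vectorSpan ℝ he hxE))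
      · refine AffineSubspace.mem_mk'.2 ?_
        have hz' := vsub_mem_vectorSpan ℝ hz hxB'
        rw [(le_affineDim_of_linearIndependent_sub hxB' (fun i => hd i n) hnli).2 hBdim] at hz'
        refine Submodule.span_le.2 ?_ hz'
        rintro _ ⟨i, rfl⟩
        exact ⟨c i - xbar, vsub_mem_vectorSpan ℝ (hBE (hc i)) hxE, hAb n i⟩
    have hle : vectorSpan ℝ (K : Set H) ≤
        (vectorSpan ℝ (E.1 : Set H)).map (A n : H →ₗ[ℝ] H) := by
      have h := AffineSubspace.direction_le (affineSpan_le.2 hsub)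
      rw [← affineSpan_convexHull, direction_affineSpan, AffineSubspace.direction_mk'] at h
      exact h
    exact (Submodule.finrank_mono hle).trans ((Submodule.finrank_map_le _ _).trans hEdim)
  refine ⟨⟨K, hKX⟩, ⟨⟨convex_convexHull ℝ _, hKdim, hBK hxB'⟩, hBK⟩, ?_⟩
  refine Metric.hausdorffDist_le_of_mem_dist hε.le (fun e he => ?_) (fun z hz => ?_)
  · exact ⟨p e, hSK ⟨e, he, rfl⟩, by rw [dist_comm]; exact hpdist e he⟩
  · have hnear : S ∪ ((B n).1 : Set H) ⊆ Metric.cthickening ε (E.1 : Set H) := by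
      rintro z (⟨e, he, rfl⟩ | hz)
      · exact Metric.mem_cthickening_of_dist_le _ _ _ _ he (hpdist e he)
      · obtain ⟨y, hy, hzy⟩ := Bbar.1.isCompact.exists_infDist_eq_dist Bbar.1.nonempty z
        refine Metric.mem_cthickening_of_dist_le _ _ _ _ (hBE hy) ?_
        rw [← hzy]
        refine (Metric.infDist_le_hausdorffDist_of_mem hz ?_).trans hnB
        exact edist_ne_top (B n).1 Bbar.1
    have hz' := convexHull_min hnear (hEconv.cthickening ε) hz
    rw [E.1.isCompact.cthickening_eq_biUnion_closedBall hε.le] at hz'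
    simpa using hz'

/-- Γ-convergence of the constraint indicators, when the limit of the prescribed subsets has the
maximal dimension. -/
theorem gammaTendsto_chi_nestedFamily {X : Set H} (hXconv : Convex ℝ X)
    {x : ℕ → X} {xbar : X} (hxbar : (xbar : H) ∈ interior X) (hx : Tendsto x atTop (𝓝 xbar))
    {m : ℕ} {B : ℕ → CL X} {Bbar : CL X} (hBmem : ∀ n, B n ∈ CC (x n) m)
    (hB : Tendsto B atTop (𝓝 Bbar)) (hdim : affineDim (Bbar.1 : Set H) = m) :
    GammaTendsto (fun n => chi (nestedFamily (x n) (m + 1) (B n)))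
      (chi (nestedFamily xbar (m + 1) Bbar)) := by
  have hself : ∀ n, B n ∈ nestedFamily (x n) (m + 1) (B n) := fun n =>
    ⟨⟨(hBmem n).1, (hBmem n).2.1.trans m.le_succ, (hBmem n).2.2⟩, subset_rfl⟩
  have hxB : (xbar : H) ∈ (Bbar.1 : Set H) :=
    (mem_nestedFamily_of_frequently hx hB hB (Frequently.of_forall hself)).1.2.2
  refine gammaTendsto_chi (fun u y hu hmem => mem_nestedFamily_of_frequently hx hB hu hmem)
    fun y hy => exists_tendsto_of_eventually_dist_le (fun n => ⟨B n, hself n⟩) fun ε hε => ?_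
  exact eventually_exists_mem_nestedFamily_dist_le hXconv hxbar hx hBmem hB hxB hdim hy hε

end Recovery

/-! ### Minimization of the risk -/

section Risk

variable {H : Type*} [NormedAddCommGroup H] [MeasurableSpace H] {X : Set H}

theorem penalizedJ_of_mem {μ : ProbabilityMeasure X} {A : Set (CL X)} {C : CL X} (h : C ∈ A) :
    penalizedJ μ A C = J C μ := by
  rw [penalizedJ, chi_of_mem h, add_zero]

theorem penalizedJ_of_notMem {μ : ProbabilityMeasure X} {A : Set (CL X)} {C : CL X} (h : C ∉ A) :
    penalizedJ μ A C = ⊤ := by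
  rw [penalizedJ, chi_of_notMem h, EReal.coe_add_top]

/-- Nonemptiness matters: for `A = ∅` the penalized risk is constantly `⊤`, and every set attains
its infimum. -/
theorem mem_argmin_penalizedJ {μ : ProbabilityMeasure X} {A : Set (CL X)} (hA : A.Nonempty)
    {E : CL X} : E ∈ argmin (penalizedJ μ A) ↔ E ∈ A ∧ ∀ D ∈ A, J E μ ≤ J D μ := by
  constructor
  · intro h
    have hle : ∀ D, penalizedJ μ A E ≤ penalizedJ μ A D := fun D => by
      rw [show penalizedJ μ A E = ⨅ z, penalizedJ μ A z from h]
      exact iInf_le _ D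
    have hE : E ∈ A := by
      by_contra hE
      obtain ⟨D, hD⟩ := hA
      have h1 := hle D
      rw [penalizedJ_of_notMem hE, penalizedJ_of_mem hD] at h1
      exact EReal.coe_ne_top _ (top_le_iff.1 h1)
    refine ⟨hE, fun D hD => ?_⟩
    have h1 := hle D
    rwa [penalizedJ_of_mem hE, penalizedJ_of_mem hD, EReal.coe_le_coe_iff] at h1
  · rintro ⟨hE, hmin⟩
    refine le_antisymm (le_iInf fun D => ?_) (iInf_le _ E)
    by_cases hD : D ∈ A
    · rw [penalizedJ_of_mem hE, penalizedJ_of_mem hD]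
      exact EReal.coe_le_coe_iff.2 (hmin D hD)
    · rw [penalizedJ_of_notMem hD]
      exact le_top

/-- Γ-convergence of the penalized risks, from that of the constraint indicators. -/
theorem gammaTendsto_penalizedJ [BorelSpace H] (hX : IsCompact X) {μs : ℕ → ProbabilityMeasure X}
    {μ : ProbabilityMeasure X} (hμ : Tendsto μs atTop (𝓝 μ)) {A : ℕ → Set (CL X)} {B : Set (CL X)}
    (h : GammaTendsto (fun n => chi (A n)) (chi B)) :
    GammaTendsto (fun n => penalizedJ (μs n) (A n)) (penalizedJ μ B) :=
  h.coe_add (f := fun n C => J C (μs n)) fun _ _ hu => tendsto_J hX hu hμ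

/-- Enlarging a set by a point of the support outside it strictly decreases the risk. -/
theorem J_lt_of_mem_support [BorelSpace H] (hX : IsCompact X) {μ : ProbabilityMeasure X}
    {C D : CL X}
    (hCD : (C.1 : Set H) ⊆ (D.1 : Set H)) {y : X} (hy : y ∈ (μ : Measure X).support)
    (hyC : (y : H) ∉ (C.1 : Set H)) (hyD : (y : H) ∈ (D.1 : Set H)) : J D μ < J C μ := by
  have : CompactSpace X := isCompact_iff_compactSpace.1 hX
  have hle : ∀ z, distSq D z ≤ distSq C z := fun z =>
    pow_le_pow_left₀ Metric.infDist_nonneg (Metric.infDist_le_infDist_of_subset hCD C.1.nonempty) 2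
  have hpos : distSq C y - distSq D y ≠ 0 := by
    have h : 0 < Metric.infDist (y : H) (C.1 : Set H) :=
      (C.1.isCompact.isClosed.notMem_iff_infDist_pos C.1.nonempty).1 hyC
    rw [distSq_apply, distSq_apply, Metric.infDist_zero_of_mem hyD, zero_pow two_ne_zero, sub_zero]
    exact pow_ne_zero 2 h.ne'
  have hcont : Continuous fun z => distSq C z - distSq D z := by fun_prop
  have hint : 0 < ∫ z, distSq C z - distSq D z ∂(μ : Measure X) := by
    rw [integral_pos_iff_support_of_nonneg (fun z => sub_nonneg.2 (hle z))
      (((distSq C).integrable _).sub ((distSq D).integrable _))]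
    exact (Measure.mem_support_iff_forall y).1 hy _ (hcont.isOpen_support.mem_nhds hpos)
  rw [integral_sub ((distSq C).integrable _) ((distSq D).integrable _)] at hint
  exact sub_pos.1 hint

end Risk

/-! ### Dimension of the minimizers -/

section Minimizers

variable {H : Type*} [NormedAddCommGroup H] [InnerProductSpace ℝ H] [FiniteDimensional ℝ H]
  [MeasurableSpace H] [BorelSpace H] {X : Set H}

/-- A minimizer of the nested problem uses all the available dimensions. Otherwise the support of
the measure has a point outside it, and adding that point costs one dimension only. -/
theorem affineDim_eq_of_minimizer (hX : IsCompact X) (hXconv : Convex ℝ X) {x : X}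
    {μ : ProbabilityMeasure X} {l : ℕ}
    (hdim : l + 1 ≤ affineDim (Subtype.val '' (μ : Measure X).support : Set H)) {B E : CL X}
    (hE : E ∈ nestedFamily x (l + 1) B) (hmin : ∀ D ∈ nestedFamily x (l + 1) B, J E μ ≤ J D μ) :
    affineDim (E.1 : Set H) = l + 1 := by
  obtain ⟨⟨hEconv, hEdim, hxE⟩, hBE⟩ := hE
  by_contra hne
  have hEl : affineDim (E.1 : Set H) ≤ l := by omega
  obtain ⟨y, hy, hyE⟩ : ∃ y ∈ (μ : Measure X).support, (y : H) ∉ (E.1 : Set H) := by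
    by_contra! hcon
    have hsub : Subtype.val '' (μ : Measure X).support ⊆ (E.1 : Set H) := by
      rintro _ ⟨y, hy, rfl⟩
      exact hcon y hy
    have h : affineDim (Subtype.val '' (μ : Measure X).support : Set H) ≤ affineDim (E.1 : Set H) :=
      Submodule.finrank_mono (vectorSpan_mono ℝ hsub)
    omega
  let K : NonemptyCompacts H :=
    ⟨⟨convexHull ℝ ({(y : H)} ∪ (E.1 : Set H)),
      isCompact_convexHull_union isCompact_singleton E.1.isCompact (convex_singleton _) hEconv
        (Set.singleton_nonempty _) E.1.nonempty⟩,
      (E.1.nonempty.mono Set.subset_union_right).convexHull⟩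
  have hKX : (K : Set H) ⊆ X :=
    convexHull_min (Set.union_subset (Set.singleton_subset_iff.2 y.2) E.2) hXconv
  have hEK : (E.1 : Set H) ⊆ (K : Set H) := Set.subset_union_right.trans (subset_convexHull ℝ _)
  have hyK : (y : H) ∈ (K : Set H) := subset_convexHull ℝ _ (Set.mem_union_left _ rfl)
  have hKdim : affineDim (K : Set H) ≤ l + 1 := by
    have h : vectorSpan ℝ (K : Set H) = vectorSpan ℝ (insert (y : H) (E.1 : Set H)) := by
      rw [← direction_affineSpan, ← direction_affineSpan, Set.insert_eq]
      exact congrArg _ (affineSpan_convexHull _)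
    unfold affineDim
    rw [h]
    exact (finrank_vectorSpan_insert_le_set ℝ _ _).trans (Nat.succ_le_succ hEl)
  exact (hmin ⟨K, hKX⟩ ⟨⟨convex_convexHull ℝ _, hKdim, hEK hxE⟩, hBE.trans hEK⟩).not_gt
    (J_lt_of_mem_support hX hEK hy hyE hyK)

end Minimizers

/-! ### Limits of nested chains -/

section Chains

variable {H : Type*} [NormedAddCommGroup H] [InnerProductSpace ℝ H] [FiniteDimensional ℝ H]
  {X : Set H}

theorem affineDim_singleton (p : H) : affineDim ({p} : Set H) = 0 := by
  rw [affineDim, vectorSpan_singleton, finrank_bot]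

variable [MeasurableSpace H]

theorem IsNestedChain.of_le {x : X} {μ : ProbabilityMeasure X} {k j : ℕ} {C : ℕ → CL X}
    (h : IsNestedChain x μ k C) (hj : j ≤ k) : IsNestedChain x μ j C :=
  ⟨h.1, fun l hl => h.2 l (hl.trans_le hj)⟩

theorem IsNestedChain.isNestedCPC {x : X} {μ : ProbabilityMeasure X} {k : ℕ} {C : ℕ → CL X}
    (h : IsNestedChain x μ k C) {j : ℕ} (hj : j ≤ k) : IsNestedCPC x μ j (C j) :=
  ⟨C, h.of_le hj, rfl⟩

theorem IsNestedCPC.mem_CC {x : X} {μ : ProbabilityMeasure X} {j : ℕ} {B : CL X}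
    (h : IsNestedCPC x μ j B) : B ∈ CC x j := by
  obtain ⟨C, hC, rfl⟩ := h
  cases j with
  | zero =>
    change Convex ℝ ((C 0).1 : Set H) ∧ affineDim ((C 0).1 : Set H) ≤ 0 ∧ (x : H) ∈ ((C 0).1 : Set H)
    rw [hC.1]
    exact ⟨convex_singleton _, (affineDim_singleton _).le, rfl⟩
  | succ l => exact (hC.2 l l.lt_succ_self).1.1

variable [BorelSpace H]

theorem IsNestedCPC.affineDim_eq (hX : IsCompact X) (hXconv : Convex ℝ X) {x : X}
    {μ : ProbabilityMeasure X} {j : ℕ} {B : CL X} (h : IsNestedCPC x μ j B)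
    (hdim : j ≤ affineDim (Subtype.val '' (μ : Measure X).support : Set H)) :
    affineDim (B.1 : Set H) = j := by
  obtain ⟨C, hC, rfl⟩ := h
  cases j with
  | zero => rw [hC.1, affineDim_singleton]
  | succ l =>
    exact affineDim_eq_of_minimizer hX hXconv hdim (hC.2 l l.lt_succ_self).1
      (hC.2 l l.lt_succ_self).2

variable {x : ℕ → X} {xbar : X} {μs : ℕ → ProbabilityMeasure X} {μ : ProbabilityMeasure X}

/-- Limits of sequentially optimal chains are sequentially optimal. The induction along the chain
needs optimality of the first `l` limits in order to know that the `l`-th one has dimension `l`, so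
that the constraints of the next step Γ-converge. -/
theorem isNestedChain_of_tendsto (hX : IsCompact X) (hXconv : Convex ℝ X)
    (hxbar : (xbar : H) ∈ interior X) (hx : Tendsto x atTop (𝓝 xbar))
    (hμ : Tendsto μs atTop (𝓝 μ)) {j : ℕ}
    (hdim : j ≤ affineDim (Subtype.val '' (μ : Measure X).support : Set H))
    {C : ℕ → ℕ → CL X} (hC : ∀ n, IsNestedChain (x n) (μs n) j (C n)) {E : ℕ → CL X}
    (hE : ∀ l, l ≤ j → Tendsto (fun n => C n l) atTop (𝓝 (E l))) :
    IsNestedChain xbar μ j E := by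
  have : CompactSpace (CL X) := compactSpace_CL hX
  have hx' : Tendsto (fun n => (x n : H)) atTop (𝓝 (xbar : H)) :=
    (continuous_subtype_val.tendsto _).comp hx
  suffices h : ∀ l, l ≤ j → IsNestedChain xbar μ l E from h j le_rfl
  intro l
  induction l with
  | zero =>
    intro _
    have hE0 : Tendsto (fun n => (C n 0).1) atTop (𝓝 (E 0).1) :=
      (continuous_subtype_val.tendsto _).comp (hE 0 j.zero_le)
    refine ⟨Set.Subset.antisymm (fun z hz => ?_) (Set.singleton_subset_iff.2 ?_),
      fun l hl => absurd hl l.not_lt_zero⟩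
    · obtain ⟨u, hu, huz⟩ := exists_tendsto_of_mem hE0 hz
      have hux : ∀ n, u n = x n := fun n => by
        have h := hu n
        rwa [(hC n).1] at h
      exact tendsto_nhds_unique (huz.congr hux) hx'
    · exact mem_of_tendsto_of_mem hE0 hx' fun n => by rw [(hC n).1]; rfl
  | succ l ih =>
    intro hl
    have hchain := ih (l.le_succ.trans hl)
    have hgamma := gammaTendsto_penalizedJ hX hμ
      (gammaTendsto_chi_nestedFamily hXconv hxbar hx (m := l)
        (fun n => ((hC n).isNestedCPC (l.le_succ.trans hl)).mem_CC) (hE l (l.le_succ.trans hl))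
        ((hchain.isNestedCPC le_rfl).affineDim_eq hX hXconv (l.le_succ.trans (hl.trans hdim))))
    have hmem : E (l + 1) ∈ nestedFamily xbar (l + 1) (E l) :=
      mem_nestedFamily_of_frequently hx (hE l (l.le_succ.trans hl)) (hE (l + 1) hl)
        (Frequently.of_forall fun n => ((hC n).2 l hl).1)
    have hmin := (mem_argmin_penalizedJ ⟨_, hmem⟩).1 (hgamma.mem_argmin
      (fun n => (mem_argmin_penalizedJ ⟨_, ((hC n).2 l hl).1⟩).2 ((hC n).2 l hl))
      (hE (l + 1) hl).mapClusterPt)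
    refine ⟨hchain.1, fun i hi => ?_⟩
    rcases Nat.lt_succ_iff_lt_or_eq.1 hi with hi | rfl
    · exact hchain.2 i hi
    · exact hmin

/-- Limits of nested convex principal components are nested convex principal components: along a
subsequence the chains that they terminate converge as well. -/
theorem isNestedCPC_of_tendsto (hX : IsCompact X) (hXconv : Convex ℝ X)
    (hxbar : (xbar : H) ∈ interior X) (hx : Tendsto x atTop (𝓝 xbar))
    (hμ : Tendsto μs atTop (𝓝 μ)) {j : ℕ}
    (hdim : j ≤ affineDim (Subtype.val '' (μ : Measure X).support : Set H))
    {B : ℕ → CL X} (hB : ∀ n, IsNestedCPC (x n) (μs n) j (B n)) {E : CL X}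
    (hE : Tendsto B atTop (𝓝 E)) : IsNestedCPC xbar μ j E := by
  have : CompactSpace (CL X) := compactSpace_CL hX
  choose C hC hCB using hB
  obtain ⟨G, φ, hφ, hG⟩ := CompactSpace.tendsto_subseq C
  have hG' : ∀ l, Tendsto (fun i => C (φ i) l) atTop (𝓝 (G l)) := tendsto_pi_nhds.1 hG
  refine ⟨G, isNestedChain_of_tendsto hX hXconv hxbar (hx.comp hφ.tendsto_atTop)
    (hμ.comp hφ.tendsto_atTop) hdim (fun i => hC (φ i)) fun l _ => hG' l, ?_⟩
  have h := hG' j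
  simp only [hCB] at h
  exact tendsto_nhds_unique h (hE.comp hφ.tendsto_atTop)

end Chains

end ConvexPCA

/-! ### Consistency of nested convex PCA -/

theorem mainTheorem1
    {H : Type*} [NormedAddCommGroup H] [InnerProductSpace ℝ H] [FiniteDimensional ℝ H]
    [MeasurableSpace H] [BorelSpace H]
    (X : Set H) (hX : IsCompact X) (hXconv : Convex ℝ X)
    (xbar : X) (hxbar : (xbar : H) ∈ interior X)
    (x : ℕ → X) (hx : Tendsto x atTop (𝓝 xbar))
    (μ : ProbabilityMeasure X) (μs : ℕ → ProbabilityMeasure X) (hμ : Tendsto μs atTop (𝓝 μ))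
    (k : ℕ) (hk : 1 ≤ k)
    (hdim : k ≤ affineDim (Subtype.val '' (μ : Measure X).support : Set H))
    (Cs : ℕ → ℕ → CL X)
    (hCs_zero : ∀ n, ((Cs n 0).1 : Set H) = {(x n : H)})
    (hCs_mono : ∀ n j, j < k → ((Cs n j).1 : Set H) ⊆ ((Cs n (j + 1)).1 : Set H))
    (hCs : ∀ n j, j ≤ k → IsNestedCPC (x n) (μs n) j (Cs n j)) :
    ∃ φ : ℕ → ℕ, StrictMono φ ∧ ∃ C : ℕ → CL X,
      -- the sets converge in Hausdorff distance
      (∀ j, j ≤ k → Tendsto (fun i => Cs (φ i) j) atTop (𝓝 (C j)) ∧ C j ∈ CC xbar j) ∧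
      -- the limits are increasing nested convex principal components of the limit problem
      (∀ j, j < k → ((C j).1 : Set H) ⊆ ((C (j + 1)).1 : Set H)) ∧
      (∀ j, j ≤ k → IsNestedCPC xbar μ j (C j)) ∧
      -- successive optimality within the given chains passes to the limit chain
      ((∀ i, IsNestedChain (x (φ i)) (μs (φ i)) k (Cs (φ i))) → IsNestedChain xbar μ k C) ∧
      -- constraint indicators, optimal values and optimizers, at each level `j + 1 = 1, …, k`
      (∀ j, j < k →
        GammaTendsto (fun i => chi (nestedFamily (x (φ i)) (j + 1) (Cs (φ i) j)))
          (chi (nestedFamily xbar (j + 1) (C j))) ∧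
        Tendsto
          (fun i => ⨅ D : CL X,
            penalizedJ (μs (φ i)) (nestedFamily (x (φ i)) (j + 1) (Cs (φ i) j)) D)
          atTop
          (𝓝 (⨅ D : CL X, penalizedJ μ (nestedFamily xbar (j + 1) (C j)) D)) ∧
        ∀ D : ℕ → CL X,
          (∀ i, D i ∈
            argmin (penalizedJ (μs (φ i)) (nestedFamily (x (φ i)) (j + 1) (Cs (φ i) j)))) →
          ∀ E : CL X, MapClusterPt E atTop D →
            E ∈ argmin (penalizedJ μ (nestedFamily xbar (j + 1) (C j)))) := by
  have hcomp : CompactSpace (CL X) := compactSpace_CL hX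
  -- compactness of the product `ℕ → CL X` extracts one subsequence for all levels at once
  obtain ⟨C, φ, hφ, hC⟩ := CompactSpace.tendsto_subseq Cs
  have hlim : ∀ j, Tendsto (fun i => Cs (φ i) j) atTop (𝓝 (C j)) := tendsto_pi_nhds.1 hC
  have hxφ : Tendsto (fun i => x (φ i)) atTop (𝓝 xbar) := hx.comp hφ.tendsto_atTop
  have hμφ : Tendsto (fun i => μs (φ i)) atTop (𝓝 μ) := hμ.comp hφ.tendsto_atTop
  have hCPC : ∀ j, j ≤ k → IsNestedCPC xbar μ j (C j) := fun j hj =>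
    isNestedCPC_of_tendsto hX hXconv hxbar hxφ hμφ (hj.trans hdim) (fun i => hCs (φ i) j hj) (hlim j)
  refine ⟨φ, hφ, C, fun j hj => ⟨hlim j, (hCPC j hj).mem_CC⟩, fun j hj => ?_, hCPC,
    fun hchain => isNestedChain_of_tendsto hX hXconv hxbar hxφ hμφ hdim hchain fun l _ => hlim l,
    fun j hj => ?_⟩
  · refine (mem_nestedFamily_of_frequently (m := j + 1) hxφ (hlim j) (hlim (j + 1))
      (Frequently.of_forall fun i => ⟨(hCs (φ i) (j + 1) hj).mem_CC, hCs_mono (φ i) j hj⟩)).2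
  · have hgamma := gammaTendsto_chi_nestedFamily hXconv hxbar hxφ
      (fun i => (hCs (φ i) j hj.le).mem_CC) (hlim j)
      ((hCPC j hj.le).affineDim_eq hX hXconv (hj.le.trans hdim))
    have hpen := gammaTendsto_penalizedJ hX hμφ hgamma
    exact ⟨hgamma, hpen.tendsto_iInf, fun D hD E hE => hpen.mem_argmin hD hE⟩
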